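/- Let $\mathcal X\subseteq\mathbb R^d$ be open, let $X$ be a random vector with a probability density $\pi$ on $\mathbb R^d$ such that $X\in\mathcal X$ almost surely and $\mathcal X$ is contained in the support of the law of $X$, and let $u\in C^1(\mathcal X;\mathbb R)$. For $g\in C^1(\mathcal X;\mathbb R^m)$ put $$J(g)=\mathbb E\big[\|\nabla u(X)-\Pi_{\mathrm{range}(\nabla g(X)^T)}\nabla u(X)\|^2\big]\in[0,\infty],$$ where $\nabla g(x)\in\mathbb R^{m\times d}$ is the Jacobian and $\Pi_V$ is the orthogonal projector of $\mathbb R^d$ onto $V$. For a random variable $Y$ with values in an embedded $C^1$ submanifold $\mathcal M\subseteq\mathbb R^d$, the Poincaré constant $\mathbb C(Y)\in[0,+\infty]$ is the smallest constant such that $$\mathbb E\big[(h(Y)-\mathbb E[h(Y)])^2\big]\le \mathbb C(Y)\,\mathbb E\big[\|\nabla h(Y)\|^2\big]$$ for every continuously differentiable $h:\mathcal M\to\mathbb R$, where $\nabla h(x)\in T_x\mathcal M$ is the gradient of $h$ on $\mathcal M$ and the left-hand side is $+\infty$ when $h(Y)$ is not square integrable. Let $\mathcal G_m\subseteq C^1(\mathcal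 X;\mathbb R^m)$ be such that $\mathrm{rank}(\nabla g(x)^T)=m$ for all $g\in\mathcal G_m$ and all $x\in\mathcal X$. For each $g\in\mathcal G_m$ fix any regular conditional distribution of $X$ given $g(X)$ whose law given $g(X)=z$ is, for every $z\in g(\mathcal X)$, concentrated on the level set $g^{-1}(z)=\{x\in\mathcal X: g(x)=z\}$, and let $X\,|\,g(X)=z$ denote a random variable with that law. Assume that $$\mathbb C(X|\mathcal G_m):=\sup_{g\in\mathcal G_m}\ \sup_{z\in g(\mathcal X)}\mathbb C\big(X\,|\,g(X)=z\big)<\infty,$$ where $X\,|\,g(X)=z$ is regarded as a random variable on the submanifold $g^{-1}(z)$. Then for every $g\in\mathcal G_m$ there is a measurable $f:\mathbb R^m\to\mathbb R$, namely $f(z)=\mathbb E[u(X)\,|\,g(X)=z]$ (the integral of $u$ against the conditional law, read as $0$ where that integral does not exist) for almost every $z$ with respect to the law of $g(X)$, such that $$\mathbb E\big[(u(X)-f(g(X)))^2\big]\le \mathbb C(X|\mathcal G_m)\,J(g),$$ with both sides in $[0,\infty]$ and $0\cdot\infty=0$. -/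

import Mathlib

open MeasureTheory ProbabilityTheory
open scoped ENNReal Topology

noncomputable section

/-- The tangent space at `x` of an embedded submanifold `M ⊆ ℝᵈ`: the span of the velocities at `x`
of the `C¹` curves that run in `M` and pass through `x` at time `0` (these velocities already form
a linear subspace when `M` is an embedded `C¹` submanifold). -/
def embeddedTangentSpace {d : ℕ} (M : Set (EuclideanSpace ℝ (Fin d)))
    (x : EuclideanSpace ℝ (Fin d)) : Submodule ℝ (EuclideanSpace ℝ (Fin d)) :=
  Submodule.span ℝ {v | ∃ γ : ℝ → EuclideanSpace ℝ (Fin d),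
    ContDiffAt ℝ 1 γ 0 ∧ γ 0 = x ∧ (∀ᶠ t in 𝓝 (0 : ℝ), γ t ∈ M) ∧ deriv γ 0 = v}

/-- The Riemannian gradient at `x` of a function `h` on the embedded submanifold `M`: the vector
of the tangent space that represents the differential of `h` along `M`.
(`gradientWithin h M x` represents some linear map that is a derivative of `h` within `M`; two such
linear maps agree on velocities of curves in `M`, so that the tangential component does not depend
on which one is taken.) -/
def tangentialGradient {d : ℕ} (M : Set (EuclideanSpace ℝ (Fin d)))
    (h : EuclideanSpace ℝ (Fin d) → ℝ) (x : EuclideanSpace ℝ (Fin d)) :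
    EuclideanSpace ℝ (Fin d) :=
  (embeddedTangentSpace M x).starProjection (gradientWithin h M x)

/-- The Poincaré constant in `[0, ∞]` of a probability law `μ` on the embedded submanifold `M`:
the smallest `C` with `Var h ≤ C * E ‖∇h‖²` for all `C¹` functions `h` on `M`. The variance is `∞`
for `h` that is not square integrable. Only the values of `h` on `M` matter, and on an embedded
`C¹` submanifold `ContDiffOn ℝ 1 h M` says that `h` is `C¹` in the charts of `M`. -/
def poincareConstant {d : ℕ} (M : Set (EuclideanSpace ℝ (Fin d)))
    (μ : Measure (EuclideanSpace ℝ (Fin d))) : ℝ≥0∞ :=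
  sInf {C : ℝ≥0∞ | ∀ h : EuclideanSpace ℝ (Fin d) → ℝ, ContDiffOn ℝ 1 h M →
    evariance h μ ≤ C * ∫⁻ x, ‖tangentialGradient M h x‖ₑ ^ 2 ∂μ}

/-- The level set `g⁻¹(z)` of a map `g` on the domain `𝒳`. -/
def levelSet {d m : ℕ} (𝒳 : Set (EuclideanSpace ℝ (Fin d)))
    (g : EuclideanSpace ℝ (Fin d) → EuclideanSpace ℝ (Fin m)) (z : EuclideanSpace ℝ (Fin m)) :
    Set (EuclideanSpace ℝ (Fin d)) :=
  {x ∈ 𝒳 | g x = z}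

/-- `κ z` is the law of `X` conditioned on `g(X) = z`: a regular conditional distribution of `X`
given `g(X)`, for which the law given `g(X) = z` lives on the level set `g⁻¹(z)`. -/
structure IsConditionalLaw {Ω : Type*} [MeasurableSpace Ω] (P : Measure Ω) {d m : ℕ}
    (X : Ω → EuclideanSpace ℝ (Fin d)) (𝒳 : Set (EuclideanSpace ℝ (Fin d)))
    (g : EuclideanSpace ℝ (Fin d) → EuclideanSpace ℝ (Fin m))
    (κ : Kernel (EuclideanSpace ℝ (Fin m)) (EuclideanSpace ℝ (Fin d))) : Prop where
  isMarkovKernel : IsMarkovKernel κ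
  disintegration :
    (P.map fun ω => g (X ω)) ⊗ₘ κ = P.map fun ω => (g (X ω), X ω)
  ae_mem_levelSet : ∀ z ∈ g '' 𝒳, ∀ᵐ x ∂(κ z), x ∈ levelSet 𝒳 g z

/-- `sup_{g ∈ 𝒢} sup_{z ∈ g(𝒳)} C(X | g(X) = z)`, where `κ g z` is the law of `X` given
`g(X) = z`. -/
def conditionalPoincareConstant {d m : ℕ} (𝒳 : Set (EuclideanSpace ℝ (Fin d)))
    (𝒢 : Set (EuclideanSpace ℝ (Fin d) → EuclideanSpace ℝ (Fin m)))
    (κ : (EuclideanSpace ℝ (Fin d) → EuclideanSpace ℝ (Fin m)) →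
      Kernel (EuclideanSpace ℝ (Fin m)) (EuclideanSpace ℝ (Fin d))) : ℝ≥0∞ :=
  ⨆ g ∈ 𝒢, ⨆ z ∈ g '' 𝒳, poincareConstant (levelSet 𝒳 g z) (κ g z)

/-- The range of the transposed Jacobian `∇g(x)ᵀ`. -/
def jacobianTransposeRange {d m : ℕ}
    (g : EuclideanSpace ℝ (Fin d) → EuclideanSpace ℝ (Fin m)) (x : EuclideanSpace ℝ (Fin d)) :
    Submodule ℝ (EuclideanSpace ℝ (Fin d)) :=
  (ContinuousLinearMap.adjoint (fderiv ℝ g x)).range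

/-- The cost `J(g) = E ‖∇u(X) - Π ∇u(X)‖²` in `[0, ∞]`, with `Π` the orthogonal projector onto the
range of `∇g(X)ᵀ`. -/
def gradientCost {Ω : Type*} [MeasurableSpace Ω] (P : Measure Ω) {d m : ℕ}
    (X : Ω → EuclideanSpace ℝ (Fin d)) (u : EuclideanSpace ℝ (Fin d) → ℝ)
    (g : EuclideanSpace ℝ (Fin d) → EuclideanSpace ℝ (Fin m)) : ℝ≥0∞ :=
  ∫⁻ ω, ‖gradient u (X ω)
    - (jacobianTransposeRange g (X ω)).starProjection (gradient u (X ω))‖ₑ ^ 2 ∂P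

end

/-! Given `g(X) = z`, the best constant approximation of `u` is its conditional mean, so the error
is the average over `z` of the variance of `u` under `κ g z`. The Poincaré inequality on the level
set bounds each variance by `C` times the energy of the tangential gradient of `u`. Tangent vectors
to a level set are orthogonal to the range of `∇gᵀ`, so this gradient is at most the residual in
`J(g)` (`norm_tangentialGradient_le`), and integrating over `z` gives `C * J(g)`. The delicate point
is that the infimum defining the Poincaré constant is attained even in the case `0 * ∞`
(`evariance_le_poincareConstant_mul`). -/

section TangentSpace

variable {d m : ℕ} {M : Set (EuclideanSpace ℝ (Fin d))} {x : EuclideanSpace ℝ (Fin d)}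

/-- Derivatives within `M` of the same map agree on the tangent space of `M`. -/
lemma HasFDerivWithinAt.eq_on_embeddedTangentSpace {F : Type*} [NormedAddCommGroup F]
    [NormedSpace ℝ F] {h : EuclideanSpace ℝ (Fin d) → F}
    {L L' : EuclideanSpace ℝ (Fin d) →L[ℝ] F}
    (hL : HasFDerivWithinAt h L M x) (hL' : HasFDerivWithinAt h L' M x)
    {v : EuclideanSpace ℝ (Fin d)} (hv : v ∈ embeddedTangentSpace M x) : L v = L' v := by
  have key : embeddedTangentSpace M x ≤ LinearMap.eqLocus (L : EuclideanSpace ℝ (Fin d) →ₗ[ℝ] F) L' := by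
    refine Submodule.span_le.2 ?_
    rintro v ⟨γ, hγ, rfl, hM, rfl⟩
    have hd : HasDerivWithinAt γ (deriv γ 0) {t | γ t ∈ M} 0 :=
      (hγ.differentiableAt one_ne_zero).hasDerivAt.hasDerivWithinAt
    have hmaps : Set.MapsTo γ {t | γ t ∈ M} M := fun _ ht => ht
    -- The times at which `γ` lies in `M` form a neighbourhood of `0`, so `h ∘ γ` has a genuine,
    -- hence unique, derivative there.
    exact ((hL.comp_hasDerivWithinAt 0 hd hmaps).hasDerivAt hM).unique
      ((hL'.comp_hasDerivWithinAt 0 hd hmaps).hasDerivAt hM)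
  exact key hv

lemma tangentialGradient_eq_starProjection_gradient {h : EuclideanSpace ℝ (Fin d) → ℝ}
    (hh : DifferentiableAt ℝ h x) :
    tangentialGradient M h x = (embeddedTangentSpace M x).starProjection (gradient h x) := by
  rw [tangentialGradient, ← sub_eq_zero, ← map_sub,
    Submodule.starProjection_apply_eq_zero_iff, Submodule.mem_orthogonal']
  intro v hv
  have := hh.differentiableWithinAt.hasFDerivWithinAt.eq_on_embeddedTangentSpace
    (hh.hasFDerivAt.hasFDerivWithinAt) hv
  rw [inner_sub_left, gradientWithin, gradient, InnerProductSpace.toDual_symm_apply,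
    InnerProductSpace.toDual_symm_apply, this, sub_self]

lemma norm_tangentialGradient_le_norm_gradient {h : EuclideanSpace ℝ (Fin d) → ℝ}
    (hh : DifferentiableAt ℝ h x) : ‖tangentialGradient M h x‖ ≤ ‖gradient h x‖ := by
  rw [tangentialGradient_eq_starProjection_gradient hh]
  exact Submodule.norm_starProjection_apply_le _ _

/-- Along a level set of `g`, tangent vectors are orthogonal to the range of `∇gᵀ`. -/
lemma jacobianTransposeRange_le_orthogonal {g : EuclideanSpace ℝ (Fin d) → EuclideanSpace ℝ (Fin m)}
    (hg : DifferentiableAt ℝ g x) (hM : ∀ y ∈ M, g y = g x) :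
    jacobianTransposeRange g x ≤ (embeddedTangentSpace M x)ᗮ := by
  rintro _ ⟨w, rfl⟩
  rw [Submodule.mem_orthogonal']
  intro v hv
  have h0 : HasFDerivWithinAt g (0 : EuclideanSpace ℝ (Fin d) →L[ℝ] _) M x :=
    (hasFDerivWithinAt_const (g x) x M).congr hM rfl
  have := hg.hasFDerivAt.hasFDerivWithinAt.eq_on_embeddedTangentSpace h0 hv
  simp [ContinuousLinearMap.adjoint_inner_left, this]

/-- The tangential projection kills the component in the range of `∇gᵀ`, so it may be applied to the
residual instead, and it is a contraction. -/
lemma norm_tangentialGradient_le {g : EuclideanSpace ℝ (Fin d) → EuclideanSpace ℝ (Fin m)}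
    (hg : DifferentiableAt ℝ g x) (hM : ∀ y ∈ M, g y = g x)
    {u : EuclideanSpace ℝ (Fin d) → ℝ} (hu : DifferentiableAt ℝ u x) :
    ‖tangentialGradient M u x‖ ≤
      ‖gradient u x - (jacobianTransposeRange g x).starProjection (gradient u x)‖ := by
  have h0 : (embeddedTangentSpace M x).starProjection
      ((jacobianTransposeRange g x).starProjection (gradient u x)) = 0 :=
    (Submodule.starProjection_apply_eq_zero_iff _).2
      (jacobianTransposeRange_le_orthogonal hg hM (Submodule.starProjection_apply_mem _ _))
  rw [tangentialGradient_eq_starProjection_gradient hu,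
    ← sub_zero ((embeddedTangentSpace M x).starProjection _), ← h0, ← map_sub]
  exact Submodule.norm_starProjection_apply_le _ _

end TangentSpace

section Poincare

variable {d : ℕ} {M : Set (EuclideanSpace ℝ (Fin d))} {μ : Measure (EuclideanSpace ℝ (Fin d))}
  {h : EuclideanSpace ℝ (Fin d) → ℝ}

/-- Multiplication by a finite factor commutes with the infimum; with the factor `∞` this can fail
when the infimum is `0`. -/
lemma evariance_le_poincareConstant_mul_of_ne_top (hC : poincareConstant M μ ≠ ∞)
    (hh : ContDiffOn ℝ 1 h M)
    (hfin : ∫⁻ x, ‖tangentialGradient M h x‖ₑ ^ 2 ∂μ ≠ ∞) :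
    evariance h μ ≤ poincareConstant M μ * ∫⁻ x, ‖tangentialGradient M h x‖ₑ ^ 2 ∂μ := by
  have hne : {C : ℝ≥0∞ | ∀ h : EuclideanSpace ℝ (Fin d) → ℝ, ContDiffOn ℝ 1 h M →
      evariance h μ ≤ C * ∫⁻ x, ‖tangentialGradient M h x‖ₑ ^ 2 ∂μ}.Nonempty := by
    by_contra he
    exact hC (by rw [poincareConstant, Set.not_nonempty_iff_eq_empty.1 he, sInf_empty])
  have := hne.to_subtype
  rw [poincareConstant, sInf_eq_iInf', ENNReal.iInf_mul fun h => absurd h hfin]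
  exact le_iInf fun C => C.2 h hh

/-- A law with Poincaré constant `0` is a Dirac mass. -/
lemma exists_ae_eq_of_poincareConstant_eq_zero [IsProbabilityMeasure μ]
    (h0 : poincareConstant M μ = 0) : ∃ c, ∀ᵐ x ∂μ, x = c := by
  -- Coordinates have bounded gradient, so their energy is finite and constant `0` forces zero
  -- variance.
  have coord : ∀ i : Fin d, ∀ᵐ x ∂μ, x i = ∫ y, y i ∂μ := by
    intro i
    let p : EuclideanSpace ℝ (Fin d) →L[ℝ] ℝ := EuclideanSpace.proj i
    have hfin : ∫⁻ x, ‖tangentialGradient M p x‖ₑ ^ 2 ∂μ ≠ ∞ := by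
      refine ne_top_of_le_ne_top (b := ∫⁻ _, ‖p‖ₑ ^ 2 ∂μ) (by simp) (lintegral_mono fun x => ?_)
      gcongr
      refine enorm_le_iff_norm_le.2 ((norm_tangentialGradient_le_norm_gradient
        p.differentiableAt).trans_eq ?_)
      simp [gradient]
    have := evariance_le_poincareConstant_mul_of_ne_top (by simp [h0]) p.contDiff.contDiffOn hfin
    rw [h0, zero_mul, nonpos_iff_eq_zero,
      evariance_eq_zero_iff p.continuous.aemeasurable] at this
    exact this
  refine ⟨WithLp.toLp 2 fun i => ∫ y, y i ∂μ, ?_⟩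
  filter_upwards [ae_all_iff.2 coord] with x hx
  ext i
  exact hx i

/-- The infimum in the definition of a finite Poincaré constant is attained. -/
theorem evariance_le_poincareConstant_mul [IsProbabilityMeasure μ]
    (hC : poincareConstant M μ ≠ ∞) (hh : ContDiffOn ℝ 1 h M) :
    evariance h μ ≤ poincareConstant M μ * ∫⁻ x, ‖tangentialGradient M h x‖ₑ ^ 2 ∂μ := by
  by_cases hfin : ∫⁻ x, ‖tangentialGradient M h x‖ₑ ^ 2 ∂μ = ∞
  · rcases eq_or_ne (poincareConstant M μ) 0 with h0 | h0
    · obtain ⟨c, hc⟩ := exists_ae_eq_of_poincareConstant_eq_zero h0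
      have : h =ᵐ[μ] fun _ => h c := hc.mono fun x hx => by rw [hx]
      rw [evariance_congr this]
      simp [evariance]
    · rw [hfin, ENNReal.mul_top h0]
      exact le_top
  · exact evariance_le_poincareConstant_mul_of_ne_top hC hh hfin

end Poincare

/-- The distance to the range of the transposed Jacobian is a measurable function of the point. -/
lemma measurable_enorm_sub_starProjection_jacobianTransposeRange {d m : ℕ}
    (g : EuclideanSpace ℝ (Fin d) → EuclideanSpace ℝ (Fin m))
    {v : EuclideanSpace ℝ (Fin d) → EuclideanSpace ℝ (Fin d)} (hv : Measurable v) :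
    Measurable fun x => ‖v x - (jacobianTransposeRange g x).starProjection (v x)‖ₑ := by
  let s := TopologicalSpace.denseSeq (EuclideanSpace ℝ (Fin m))
  have hs : DenseRange s := TopologicalSpace.denseRange_denseSeq _
  -- Minimality of the projection and density of `s` turn the distance into a countable infimum of
  -- functions measurable in `x`.
  have heq : ∀ x, ‖v x - (jacobianTransposeRange g x).starProjection (v x)‖ₑ =
      ⨅ n, ‖v x - ContinuousLinearMap.adjoint (fderiv ℝ g x) (s n)‖ₑ := by
    intro x
    have hmin : ∀ w, ‖v x - (jacobianTransposeRange g x).starProjection (v x)‖ₑ ≤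
        ‖v x - ContinuousLinearMap.adjoint (fderiv ℝ g x) w‖ₑ := by
      intro w
      rw [enorm_le_iff_norm_le, Submodule.starProjection_minimal]
      exact ciInf_le ⟨0, by rintro _ ⟨y, rfl⟩; positivity⟩
        (⟨_, w, rfl⟩ : jacobianTransposeRange g x)
    refine le_antisymm (le_iInf fun n => hmin _) ?_
    obtain ⟨w, hw⟩ := Submodule.starProjection_apply_mem (jacobianTransposeRange g x) (v x)
    rw [← hw]
    have hcl : IsClosed {w | ⨅ n, ‖v x - ContinuousLinearMap.adjoint (fderiv ℝ g x) (s n)‖ₑ ≤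
        ‖v x - ContinuousLinearMap.adjoint (fderiv ℝ g x) w‖ₑ} :=
      isClosed_le continuous_const (by fun_prop)
    exact hs.induction_on w hcl fun n => iInf_le _ n
  simp_rw [heq]
  refine Measurable.iInf fun n => (hv.sub ?_).enorm
  have hadj : Measurable fun x => ContinuousLinearMap.adjoint (fderiv ℝ g x) :=
    (ContinuousLinearMap.adjoint (𝕜 := ℝ) (E := EuclideanSpace ℝ (Fin d))
      (F := EuclideanSpace ℝ (Fin m))).continuous.measurable.comp (measurable_fderiv ℝ g)
  exact hadj.apply_continuousLinearMap _

lemma measurable_gradient {d : ℕ} (u : EuclideanSpace ℝ (Fin d) → ℝ) :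
    Measurable (gradient u) :=
  (InnerProductSpace.toDual ℝ (EuclideanSpace ℝ (Fin d))).symm.continuous.measurable.comp
    (measurable_fderiv ℝ u)

/-- An open set is σ-compact, hence so is its image. -/
lemma IsOpen.measurableSet_image_of_continuousOn {d m : ℕ} {𝒳 : Set (EuclideanSpace ℝ (Fin d))}
    (h𝒳 : IsOpen 𝒳) {g : EuclideanSpace ℝ (Fin d) → EuclideanSpace ℝ (Fin m)}
    (hg : ContinuousOn g 𝒳) : MeasurableSet (g '' 𝒳) := by
  have := h𝒳.locallyCompactSpace
  have hσ : IsSigmaCompact 𝒳 := isSigmaCompact_iff_sigmaCompactSpace.2 inferInstance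
  obtain ⟨K, hK, hKU⟩ := hσ.image_of_continuousOn hg
  rw [← hKU]
  exact MeasurableSet.iUnion fun n => (hK n).measurableSet

theorem proposition3 {Ω : Type*} [MeasurableSpace Ω] (P : Measure Ω) [IsProbabilityMeasure P]
    {d m : ℕ} (𝒳 : Set (EuclideanSpace ℝ (Fin d))) (h𝒳 : IsOpen 𝒳)
    (X : Ω → EuclideanSpace ℝ (Fin d)) (hX : Measurable X)
    (π : EuclideanSpace ℝ (Fin d) → ℝ≥0∞) (hπ : Measurable π)
    (hXπ : P.map X = (volume : Measure (EuclideanSpace ℝ (Fin d))).withDensity π)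
    (hX𝒳 : ∀ᵐ ω ∂P, X ω ∈ 𝒳) (hsupp : 𝒳 ⊆ (P.map X).support)
    (u : EuclideanSpace ℝ (Fin d) → ℝ) (hu : ContDiffOn ℝ 1 u 𝒳)
    (𝒢 : Set (EuclideanSpace ℝ (Fin d) → EuclideanSpace ℝ (Fin m)))
    (h𝒢 : ∀ g ∈ 𝒢, ContDiffOn ℝ 1 g 𝒳)
    (hrank : ∀ g ∈ 𝒢, ∀ x ∈ 𝒳, Module.finrank ℝ (jacobianTransposeRange g x) = m)
    (κ : (EuclideanSpace ℝ (Fin d) → EuclideanSpace ℝ (Fin m)) →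
      Kernel (EuclideanSpace ℝ (Fin m)) (EuclideanSpace ℝ (Fin d)))
    (hκ : ∀ g ∈ 𝒢, IsConditionalLaw P X 𝒳 g (κ g))
    (hC : conditionalPoincareConstant 𝒳 𝒢 κ < ∞) :
    ∀ g ∈ 𝒢, ∃ f : EuclideanSpace ℝ (Fin m) → ℝ, Measurable f ∧
      (∀ᵐ z ∂(P.map fun ω => g (X ω)), f z = ∫ x, u x ∂(κ g z)) ∧
      ∫⁻ ω, ENNReal.ofReal ((u (X ω) - f (g (X ω))) ^ 2) ∂P
        ≤ conditionalPoincareConstant 𝒳 𝒢 κ * gradientCost P X u g := by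
  classical
  intro g hg𝒢
  obtain ⟨hmarkov, hdis, hlevel⟩ := hκ g hg𝒢
  have hg := h𝒢 g hg𝒢
  set C := conditionalPoincareConstant 𝒳 𝒢 κ
  -- a measurable representative of `u`
  let v : EuclideanSpace ℝ (Fin d) → ℝ := 𝒳.piecewise u 0
  have hv : Measurable v := hu.continuousOn.measurable_piecewise
    continuous_zero.continuousOn h𝒳.measurableSet
  have hvu : ∀ x ∈ 𝒳, v x = u x := fun x hx => Set.piecewise_eq_of_mem _ _ _ hx
  have hgX : AEMeasurable (fun ω => g (X ω)) P := by
    have hg' : Measurable (𝒳.piecewise g 0) := hg.continuousOn.measurable_piecewise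
      continuous_zero.continuousOn h𝒳.measurableSet
    exact ⟨_, hg'.comp hX, hX𝒳.mono fun ω hω => (Set.piecewise_eq_of_mem _ _ _ hω).symm⟩
  set ν := P.map fun ω => g (X ω) with hν
  have : IsProbabilityMeasure ν := Measure.isProbabilityMeasure_map hgX
  have hνim : ∀ᵐ z ∂ν, z ∈ g '' 𝒳 :=
    (ae_map_iff hgX (h𝒳.measurableSet_image_of_continuousOn hg.continuousOn)).2
      (hX𝒳.mono fun ω hω => Set.mem_image_of_mem g hω)
  have hdisint : ∀ F : EuclideanSpace ℝ (Fin m) × EuclideanSpace ℝ (Fin d) → ℝ≥0∞,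
      Measurable F → ∫⁻ ω, F (g (X ω), X ω) ∂P = ∫⁻ z, ∫⁻ x, F (z, x) ∂(κ g z) ∂ν := by
    intro F hF
    rw [← Measure.lintegral_compProd hF, hdis,
      lintegral_map' hF.aemeasurable (hgX.prodMk hX.aemeasurable)]
  have hvκ : ∀ z ∈ g '' 𝒳, v =ᵐ[κ g z] u := fun z hz =>
    (hlevel z hz).mono fun x hx => hvu x hx.1
  let f : EuclideanSpace ℝ (Fin m) → ℝ := fun z => ∫ x, v x ∂(κ g z)
  have hf : Measurable f := (hv.stronglyMeasurable.integral_kernel (κ := κ g)).measurable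
  refine ⟨f, hf, hνim.mono fun z hz => integral_congr_ae (hvκ z hz), ?_⟩
  let G : EuclideanSpace ℝ (Fin d) → ℝ≥0∞ := fun x =>
    ‖gradient u x - (jacobianTransposeRange g x).starProjection (gradient u x)‖ₑ ^ 2
  have hG : Measurable G := (measurable_enorm_sub_starProjection_jacobianTransposeRange g
    (measurable_gradient u)).pow_const 2
  have hpoincare : ∀ z ∈ g '' 𝒳, evariance v (κ g z) ≤ C * ∫⁻ x, G x ∂(κ g z) := by
    intro z hz
    rw [evariance_congr (hvκ z hz)]
    have hle : poincareConstant (levelSet 𝒳 g z) (κ g z) ≤ C :=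
      le_iSup₂_of_le g hg𝒢 (le_iSup₂_of_le z hz le_rfl)
    refine (evariance_le_poincareConstant_mul (hle.trans_lt hC).ne
      (hu.mono fun x (hx : x ∈ levelSet 𝒳 g z) => hx.1)).trans ?_
    refine mul_le_mul' hle (lintegral_mono_ae ?_)
    filter_upwards [hlevel z hz] with x hx
    have hx𝒳 := h𝒳.mem_nhds hx.1
    exact pow_le_pow_left' (enorm_le_iff_norm_le.2 (norm_tangentialGradient_le
      ((hg.contDiffAt hx𝒳).differentiableAt one_ne_zero)
      (fun y hy => hy.2.trans hx.2.symm)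
      ((hu.contDiffAt hx𝒳).differentiableAt one_ne_zero))) 2
  calc ∫⁻ ω, ENNReal.ofReal ((u (X ω) - f (g (X ω))) ^ 2) ∂P
      = ∫⁻ ω, ‖v (X ω) - f (g (X ω))‖ₑ ^ 2 ∂P := by
        refine lintegral_congr_ae (hX𝒳.mono fun ω hω => ?_)
        simp only [hvu _ hω]
        rw [← sq_abs, ENNReal.ofReal_pow (abs_nonneg _), Real.enorm_eq_ofReal_abs]
    _ = ∫⁻ z, evariance v (κ g z) ∂ν :=
        -- The inner integral is `evariance` by definition: both centre at the Bochner integral `f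
        -- z`, including its default `0`.
        hdisint (fun p => ‖v p.2 - f p.1‖ₑ ^ 2) (by fun_prop)
    _ ≤ ∫⁻ z, C * ∫⁻ x, G x ∂(κ g z) ∂ν := lintegral_mono_ae (hνim.mono hpoincare)
    _ = C * ∫⁻ z, ∫⁻ x, G x ∂(κ g z) ∂ν := lintegral_const_mul _ hG.lintegral_kernel
    _ = C * gradientCost P X u g := by
        rw [← hdisint (fun p => G p.2) (hG.comp measurable_snd)]
        rfl
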